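/- Let $\sigma$ be the surface measure on the unit sphere $S^2\subset\mathbb R^3$, and for a compact convex set $K\neq\emptyset$ with support function $h_K(\theta)=\max_{y\in K}\langle\theta,y\rangle$ let $w(K)=\frac1{4\pi}\int_{S^2}(h_K(\theta)+h_K(-\theta))\,d\sigma(\theta)$ be its mean width. For $S\subseteq S^2$ and $u\in S^2$ let $\Phi(S,u)=\frac{2}{4\pi}\int_S\max(\langle\theta,u\rangle,0)\,d\sigma(\theta)$. Let $\Gamma$ be the class of rectifiable curves in $\mathbb R^3$ whose arc length parametrization $x:[0,L]\to\mathbb R^3$ satisfies, for almost every $s\in[0,L]$, $\langle x'(s),x(s)-x(\tau)\rangle\ge 0$ for all $\tau\in[0,s]$. For $\gamma\in\Gamma$ let $\gamma(s)=\{x(\tau):0\le\tau\le s\}$ be the initial arc of length $s$, let $\|\gamma\|=L$ be the length of $\gamma$, and for $W>0$ let $\Gamma_W$ be the class of $\gamma\in\Gamma$ with $w(\mathrm{co}(\gamma))\le W$, where $\mathrm{co}$ denotes the convex hull. Let $S_0=\{\theta\in S^2:\langle\theta,b_i\rangle\ge 0,\ i=1,2,3\}$ be a spherical orthant, where $(b_1,b_2,b_3)$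 is any orthonormal basis of $\mathbb R^3$, and let $u_0\in\{b_1,b_2,b_3\}$ be one of its extreme points. Then $\Phi(S_0,u_0)=\frac18$. Moreover, for every $W>0$ there are a curve $\widehat\gamma\in\Gamma_W$, a point $\widehat s\in(0,\|\widehat\gamma\|)$ and a strictly decreasing sequence $s_m\in(\widehat s,\|\widehat\gamma\|)$ with $s_m\to\widehat s$ such that $s\mapsto w(\mathrm{co}(\widehat\gamma(s)))$ is differentiable at every $s_m$ and $$\lim_{m\to\infty}\frac{d}{ds}w(\mathrm{co}(\widehat\gamma(s)))\Big|_{s=s_m}=\Phi(S_0,u_0)=\frac18 .$$ Explicitly, the equation $\omega=e^{-3\pi\omega/2}$ has a unique real solution $\omega$, and one can take $\widehat s=W/2$ and for $\widehat\gamma$ the curve of length $\frac W2\big(\frac{\sqrt{1+\omega^2}}{\omega}+1\big)$ with arc length parametrization $$x(s)=(0,0,s-W/2)\quad(0\le s\le W/2),\qquad x(s)=(r\cos\eta,\;r\sin\eta,\;0)\quad\Big(\tfrac W2<s\le\tfrac W2\big(\tfrac{\sqrt{1+\omega^2}}{\omega}+1\big)\Big),$$ where $r=\frac{\omega\,(s-W/2)}{\sqrt{1+\omega^2}}$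 and $\eta=-\frac1\omega\log r$: a segment followed by a logarithmic spiral in the plane $x_3=0$. -/

import Mathlib

open MeasureTheory Set Filter Topology

noncomputable section

/-- `n`-dimensional Euclidean space. -/
abbrev Euc (n : ℕ) : Type := EuclideanSpace ℝ (Fin n)

/-- Spherical Lebesgue (surface) measure on the unit sphere of `ℝⁿ`. -/
def sphereMeasure (n : ℕ) : Measure (Metric.sphere (0 : Euc n) 1) :=
  (volume : Measure (Euc n)).toSphere

/-- The total measure `ω_n` of the unit sphere of `ℝⁿ`. -/
def sphereArea (n : ℕ) : ℝ := (sphereMeasure n).real univ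

/-- The support function `h_K(θ) = sup_{y ∈ K} ⟨θ, y⟩`. -/
def supportFun {n : ℕ} (K : Set (Euc n)) (θ : Euc n) : ℝ :=
  sSup ((fun y => inner ℝ θ y) '' K)

/-- The mean width of a (nonempty, bounded, convex) set: the mean over the unit sphere of the
width `h_K(θ) + h_K(-θ)`. -/
def meanWidth {n : ℕ} (K : Set (Euc n)) : ℝ :=
  1 / sphereArea n *
    ∫ θ, (supportFun K (θ : Euc n) + supportFun K (-(θ : Euc n))) ∂(sphereMeasure n)

/-- The functional `Φ(S, u) = (2 / ω_n) ∫_S ⟨θ, u⟩⁺ dσ(θ)` for a subset `S` of the unit sphere. -/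
def Phi {n : ℕ} (S : Set (Euc n)) (u : Euc n) : ℝ :=
  2 / sphereArea n *
    ∫ θ in {θ : Metric.sphere (0 : Euc n) 1 | (θ : Euc n) ∈ S},
      max (inner ℝ (θ : Euc n) u) 0 ∂(sphereMeasure n)

/-- The spherical orthant spanned by an orthonormal basis `b`; its extreme points are the `b j`. -/
def orthantSector {n : ℕ} (b : OrthonormalBasis (Fin n) ℝ (Euc n)) : Set (Euc n) :=
  {θ | θ ∈ Metric.sphere (0 : Euc n) 1 ∧ ∀ i, 0 ≤ inner ℝ (b i) θ}

/-- The class `Γ`: `x`, restricted to `[0, L]`, is the arc length parametrization of a rectifiable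
curve of length `L`, and `⟨x'(s), x(s) - x(σ)⟩ ≥ 0` for almost every `s` and all `σ ≤ s`. -/
structure IsSteepestDescent {n : ℕ} (x : ℝ → Euc n) (L : ℝ) : Prop where
  length_nonneg : 0 ≤ L
  unitSpeed : HasUnitSpeedOn x (Icc 0 L)
  descent : ∀ᵐ s ∂(volume.restrict (Icc 0 L)),
    ∃ v : Euc n, HasDerivAt x v s ∧ ∀ σ ∈ Icc 0 s, 0 ≤ inner ℝ v (x s - x σ)

/-- `w(co(γ(s)))`, where `γ(s) = {x(σ) : 0 ≤ σ ≤ s}` is the initial arc of length `s`. -/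
def hullWidth {n : ℕ} (x : ℝ → Euc n) (s : ℝ) : ℝ :=
  meanWidth (convexHull ℝ (x '' Icc 0 s))

/-- The class `Γ_W` of the curves of `Γ` whose convex hull has mean width at most `W`. -/
def MemGammaW {n : ℕ} (W : ℝ) (x : ℝ → Euc n) (L : ℝ) : Prop :=
  IsSteepestDescent x L ∧ hullWidth x L ≤ W

/-- The radius `ωσ / √(1 + ω²)` of the logarithmic spiral at arc length `σ`. -/
def spiralRadius (ω σ : ℝ) : ℝ := ω * σ / √(1 + ω ^ 2)

/-- The angle `η(σ) = -(1/ω) log (ωσ / √(1 + ω²))` of the logarithmic spiral at arc length `σ`. -/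
def spiralAngle (ω σ : ℝ) : ℝ := -(1 / ω) * Real.log (spiralRadius ω σ)

/-- The segment from `(0, 0, -W/2)` to the origin, followed by the logarithmic spiral in the plane
`x₃ = 0`. -/
def segmentSpiral (ω W s : ℝ) : Euc 3 :=
  if s ≤ W / 2 then !₂[0, 0, s - W / 2]
  else
    !₂[spiralRadius ω (s - W / 2) * Real.cos (spiralAngle ω (s - W / 2)),
      spiralRadius ω (s - W / 2) * Real.sin (spiralAngle ω (s - W / 2)), 0]

/-- The length `(W/2) (√(1 + ω²) / ω + 1)` of that curve, when the spiral is stopped on reaching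
the circle of radius `W / 2`. -/
def segmentSpiralLength (ω W : ℝ) : ℝ := W / 2 * (√(1 + ω ^ 2) / ω + 1)

end

/-!
The mean width of a convex body in `ℝ³` is `1/π` times the integral of its support function
against the Gaussian weight `exp (-‖x‖²)`, because the support function is positively homogeneous
(`meanWidth_eq_gaussian`). Gaussian integrals factor over orthogonal coordinates, which gives
`Φ(S₀, u₀) = 1/8` at once and reduces the mean width to integrals over `ℝ` and `ℂ`.

For `s > W/2` the initial arc of the curve consists of the segment and of a copy of the unit
spiral `η ↦ e^{(i-ω)η}`, `η ≥ 0`, scaled by the radius `r` reached at `s` and rotated. If `H` is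
the support function of the unit spiral, then the support function of the initial arc at
`(z, t) ∈ ℂ × ℝ` is, up to the rotation of `z`, the maximum of `r H(z)` and `(W/2) t⁻`. The Gaussian
integral is invariant under that rotation, so the mean width is `1/π ∫ max (r A) B` with fixed
integrable functions `A, B ≥ 0` (`hullWidth_segmentSpiral`). Such an integral has the derivative
`∫ A 1_{B < r A}` in `r` as long as the set of ties is a null set, and here that set lies in a
graph over `ℂ`. As `r → 0` this derivative tends to `∫ A 1_{B = 0}`: only the directions of the
upper half space see the spiral. The limit is `π/8` times the integral of `H` over the unit
circle, i.e. the perimeter of the hull of the spiral (`integral_spiralPart_halfSpace`). That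
perimeter is `√(1 + ω²)/ω`, the length of the spiral, and `dr/ds = ω/√(1 + ω²)`, so the mean width
grows at the limiting rate `1/8`.

Both the steepest descent property and the explicit form of `H` rest on the single inequality
`cos δ + ω sin δ ≤ e^{ωδ}` for `δ ≥ -3π/2` (`cos_add_mul_sin_le_exp`). The equation defining `ω` says
that equality holds at `δ = -3π/2`, that is, the tangent line at the end of the spiral touches the
spiral again three quarters of a turn earlier. The bound `w ≤ W` holds because the whole curve
lies in a ball of radius `W/2`.
-/

open scoped Pointwise

/-! ### Sphere integrals as Gaussian integrals -/

theorem integral_cube_mul_exp_neg_sq :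
    ∫ r in Ioi (0 : ℝ), r ^ 3 * Real.exp (-r ^ 2) = 1 / 2 := by
  have h := integral_rpow_mul_exp_neg_rpow (p := 2) (q := 3) (by norm_num) (by norm_num)
  have h2 : Real.Gamma 2 = 1 := by simp
  norm_num [h2] at h
  rw [← h]

theorem integral_sq_mul_exp_neg_sq :
    ∫ r in Ioi (0 : ℝ), r ^ 2 * Real.exp (-r ^ 2) = √Real.pi / 4 := by
  have h := integral_rpow_mul_exp_neg_rpow (p := 2) (q := 2) (by norm_num) (by norm_num)
  have h2 : Real.Gamma (3 / 2) = √Real.pi / 2 := by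
    have := Real.Gamma_add_one (s := 1 / 2) (by norm_num)
    rw [Real.Gamma_one_half_eq] at this
    norm_num at this
    rw [this]; ring
  norm_num [h2] at h
  trans 1 / 2 * (√Real.pi / 2)
  · rw [← h]
  · ring

theorem integral_id_mul_exp_neg_sq :
    ∫ r in Ioi (0 : ℝ), r * Real.exp (-r ^ 2) = 1 / 2 := by
  have h := integral_rpow_mul_exp_neg_rpow (p := 2) (q := 1) (by norm_num) (by norm_num)
  norm_num at h
  rw [← h]

theorem integral_exp_neg_sq_Ioi :
    ∫ r in Ioi (0 : ℝ), Real.exp (-r ^ 2) = √Real.pi / 2 := by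
  have h := integral_gaussian_Ioi 1
  simpa using h

/-- For a positively homogeneous function the radial part of a Gaussian integral splits off, so
that its integral over the sphere is a Gaussian integral over the whole space. -/
theorem integral_sphereMeasure_eq_gaussian {f : Euc 3 → ℝ}
    (hf : ∀ r : ℝ, 0 < r → ∀ x, f (r • x) = r * f x) :
    ∫ θ, f (θ : Euc 3) ∂(sphereMeasure 3) = 2 * ∫ x : Euc 3, f x * Real.exp (-‖x‖ ^ 2) := by
  have hd : Module.finrank ℝ (Euc 3) = 3 := by simp
  have h1 : ∫ x : Euc 3, f x * Real.exp (-‖x‖ ^ 2) =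
      ∫ p, f (p.1 : Euc 3) * (p.2.1 * Real.exp (-p.2.1 ^ 2))
        ∂((volume : Measure (Euc 3)).toSphere.prod (Measure.volumeIoiPow 2)) := by
    calc
      _ = ∫ x : ({(0 : Euc 3)}ᶜ : Set (Euc 3)),
          f x.1 * Real.exp (-‖x.1‖ ^ 2) ∂((volume : Measure (Euc 3)).comap (↑)) := by
        rw [integral_subtype_comap (measurableSet_singleton _).compl
          fun x => f x * Real.exp (-‖x‖ ^ 2), restrict_compl_singleton]
      _ = _ := by
        have h := (volume : Measure (Euc 3)).measurePreserving_homeomorphUnitSphereProd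
        rw [hd] at h
        rw [← h.integral_comp (Homeomorph.measurableEmbedding _)]
        refine integral_congr_ae (.of_forall fun x => ?_)
        have hx : 0 < ‖x.1‖ := norm_pos_iff.2 x.2
        have := hf ‖x.1‖⁻¹ (inv_pos.2 hx) x.1
        simp only [homeomorphUnitSphereProd_apply_snd_coe, homeomorphUnitSphereProd_apply_fst_coe,
          this]
        field_simp
  have h2 : ∫ r : Ioi (0 : ℝ), (r.1 * Real.exp (-r.1 ^ 2)) ∂(Measure.volumeIoiPow 2) = 1 / 2 := by
    rw [← integral_cube_mul_exp_neg_sq]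
    simp only [Measure.volumeIoiPow, ENNReal.ofReal]
    rw [integral_withDensity_eq_integral_smul,
      integral_subtype_comap measurableSet_Ioi
        fun a => Real.toNNReal (a ^ 2) • (a * Real.exp (-a ^ 2)),
      setIntegral_congr_fun measurableSet_Ioi fun x hx => ?_]
    · rw [NNReal.smul_def, Real.coe_toNNReal _ (by positivity), smul_eq_mul]; ring
    · exact (measurable_subtype_coe.pow_const _).real_toNNReal
  rw [h1, integral_prod_mul (fun θ : Metric.sphere (0 : Euc 3) 1 => f θ)
    (fun r : Ioi (0 : ℝ) => r.1 * Real.exp (-r.1 ^ 2)), h2, sphereMeasure]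
  ring

theorem sphereArea_three : sphereArea 3 = 4 * Real.pi := by
  rw [sphereArea, sphereMeasure, Measure.toSphere_real_apply_univ, measureReal_def,
    EuclideanSpace.volume_ball_fin_three, ENNReal.ofReal_one, one_pow, one_mul,
    ENNReal.toReal_ofReal (by positivity)]
  simp
  ring

/-- The point of `ℝ³ = ℂ × ℝ` with horizontal part `z` and height `t`. -/
def eucOfProd (p : ℂ × ℝ) : Euc 3 := !₂[p.1.re, p.1.im, p.2]

theorem measurePreserving_eucOfProd :
    MeasurePreserving eucOfProd ∧ MeasurableEmbedding eucOfProd := by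
  have e1 := PiLp.volume_preserving_toLp (Fin 3)
  have e2 := (volume_preserving_piFinSuccAbove (fun _ : Fin 3 => ℝ) 2).symm
  have e3 := (MeasurePreserving.id (volume : Measure ℝ)).prod Complex.volume_preserving_equiv_pi
  have e4 := Measure.measurePreserving_swap (μ := (volume : Measure ℂ)) (ν := (volume : Measure ℝ))
  have m1 := (MeasurableEquiv.toLp 2 (Fin 3 → ℝ)).measurableEmbedding
  have m2 := (MeasurableEquiv.piFinSuccAbove (fun _ : Fin 3 => ℝ) 2).symm.measurableEmbedding
  have m3 := (MeasurableEquiv.refl ℝ).measurableEmbedding.prodMap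
    Complex.measurableEquivPi.measurableEmbedding
  have m4 := (MeasurableEquiv.prodComm (α := ℂ) (β := ℝ)).measurableEmbedding
  have hfun : eucOfProd = WithLp.toLp 2 ∘
      (MeasurableEquiv.piFinSuccAbove (fun _ : Fin 3 => ℝ) 2).symm ∘
      Prod.map id Complex.measurableEquivPi ∘ Prod.swap := by
    ext p i
    fin_cases i <;> rfl
  rw [hfun]
  exact ⟨e1.comp (e2.comp (e3.comp e4)), m1.comp (m2.comp (m3.comp m4))⟩

theorem norm_eucOfProd_sq (p : ℂ × ℝ) : ‖eucOfProd p‖ ^ 2 = ‖p.1‖ ^ 2 + p.2 ^ 2 := by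
  simp [eucOfProd, EuclideanSpace.norm_sq_eq, Fin.sum_univ_three, Complex.sq_norm,
    Complex.normSq_apply]
  ring

/-! ### Mean width and the orthant functional -/

/-- The mean width is a Gaussian integral of the support function, because the latter is
positively homogeneous. -/
theorem meanWidth_eq_gaussian {K : Set (Euc 3)}
    (hK : Integrable fun x : Euc 3 => supportFun K x * Real.exp (-‖x‖ ^ 2)) :
    meanWidth K = 1 / Real.pi * ∫ x : Euc 3, supportFun K x * Real.exp (-‖x‖ ^ 2) := by
  have hom : ∀ r : ℝ, 0 < r → ∀ x, supportFun K (r • x) = r * supportFun K x := by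
    intro r hr x
    have : (fun y => inner ℝ (r • x) y) '' K = r • ((fun y => inner ℝ x y) '' K) := by
      rw [← image_smul, image_image]
      simp only [real_inner_smul_left, smul_eq_mul]
    rw [supportFun, this, Real.sSup_smul_of_nonneg hr.le, smul_eq_mul, supportFun]
  have hK' : Integrable fun x : Euc 3 => supportFun K (-x) * Real.exp (-‖x‖ ^ 2) := by
    simpa using hK.comp_neg
  rw [meanWidth, sphereArea_three, integral_sphereMeasure_eq_gaussian
    (f := fun x => supportFun K x + supportFun K (-x))]
  · simp only [add_mul]
    have hneg : ∫ x : Euc 3, supportFun K (-x) * Real.exp (-‖x‖ ^ 2) =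
        ∫ x : Euc 3, supportFun K x * Real.exp (-‖x‖ ^ 2) := by
      rw [← integral_neg_eq_self]
      simp
    rw [integral_add hK hK', hneg]
    field_simp
    ring
  · intro r hr x
    rw [← smul_neg, hom r hr, hom r hr, mul_add]

theorem supportFun_convexHull {n : ℕ} {A : Set (Euc n)} {x : Euc n} {M : ℝ}
    (h : IsLUB ((fun y => inner ℝ x y) '' A) M) : supportFun (convexHull ℝ A) x = M := by
  have hM : IsLUB ((fun y => inner ℝ x y) '' convexHull ℝ A) M := by
    refine ⟨?_, fun N hN => h.2 (upperBounds_mono_set (image_mono (subset_convexHull ℝ A)) hN)⟩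
    rintro _ ⟨y, hy, rfl⟩
    have hconv : Convex ℝ {y : Euc n | inner ℝ x y ≤ M} :=
      convex_halfSpace_le (innerₛₗ ℝ x).isLinear M
    exact convexHull_min (fun z hz => h.1 ⟨z, hz, rfl⟩) hconv hy
  refine hM.csSup_eq ?_
  by_contra hne
  rw [not_nonempty_iff_eq_empty] at hne
  rw [hne] at hM
  have := hM.2 (show M - 1 ∈ upperBounds ∅ by simp)
  linarith

theorem meanWidth_convexHull_le {A : Set (Euc 3)} {R : ℝ} (hne : A.Nonempty)
    (hA : ∀ y ∈ A, ‖y‖ ≤ R) : meanWidth (convexHull ℝ A) ≤ 2 * R := by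
  have hball : convexHull ℝ A ⊆ Metric.closedBall 0 R :=
    convexHull_min (fun y hy => by simpa using hA y hy) (convex_closedBall 0 R)
  have hsup : ∀ x : Euc 3, ‖x‖ = 1 → |supportFun (convexHull ℝ A) x| ≤ R := by
    intro x hx
    have hb : ∀ y ∈ convexHull ℝ A, |inner ℝ x y| ≤ R := fun y hy => by
      have h1 := abs_real_inner_le_norm x y
      have h2 := mem_closedBall_zero_iff.1 (hball hy)
      rw [hx, one_mul] at h1
      exact h1.trans h2
    obtain ⟨y, hy⟩ := (convexHull_nonempty_iff (𝕜 := ℝ)).2 hne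
    have hbdd : BddAbove ((fun y => inner ℝ x y) '' convexHull ℝ A) := by
      refine ⟨R, ?_⟩
      rintro _ ⟨z, hz, rfl⟩
      exact (abs_le.1 (hb z hz)).2
    refine abs_le.2 ⟨(abs_le.1 (hb y hy)).1.trans (le_csSup hbdd ⟨y, hy, rfl⟩), ?_⟩
    refine csSup_le ⟨_, y, hy, rfl⟩ ?_
    rintro _ ⟨z, hz, rfl⟩
    exact (abs_le.1 (hb z hz)).2
  have : IsFiniteMeasure (sphereMeasure 3) := by unfold sphereMeasure; infer_instance
  have hint := norm_integral_le_of_norm_le_const (μ := sphereMeasure 3) (C := 2 * R)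
    (f := fun θ => supportFun (convexHull ℝ A) (θ : Euc 3) +
      supportFun (convexHull ℝ A) (-(θ : Euc 3))) (.of_forall fun θ => by
        have h1 := hsup θ (by simp)
        have h2 := hsup (-θ) (by simp)
        refine (norm_add_le _ _).trans ?_
        simp only [Real.norm_eq_abs]
        linarith)
  have harea : 0 < sphereArea 3 := by
    rw [sphereArea_three]
    positivity
  have h3 := (le_abs_self _).trans hint
  rw [← sphereArea] at h3
  rw [meanWidth, one_div, inv_mul_le_iff₀ harea]
  linarith

/-- The Gaussian integral computing `Φ` factors over the coordinates of the basis. -/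
theorem Phi_orthantSector (b : OrthonormalBasis (Fin 3) ℝ (Euc 3)) (j : Fin 3) :
    Phi (orthantSector b) (b j) = 1 / 8 := by
  set C : Set (Euc 3) := {x | ∀ i, 0 ≤ inner ℝ (b i) x} with hC
  set f : Euc 3 → ℝ := C.indicator fun x => max (inner ℝ x (b j)) 0 with hf
  have hCm : IsClosed C := by
    rw [hC, ofPred_forall]
    exact isClosed_iInter fun i => isClosed_le continuous_const (by fun_prop)
  have h1 : ∫ θ in {θ : Metric.sphere (0 : Euc 3) 1 | (θ : Euc 3) ∈ orthantSector b},
      max (inner ℝ (θ : Euc 3) (b j)) 0 ∂(sphereMeasure 3) =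
      ∫ θ, f (θ : Euc 3) ∂(sphereMeasure 3) := by
    rw [← integral_indicator]
    · refine integral_congr_ae (.of_forall fun θ => ?_)
      simp only [hf, indicator, orthantSector, hC, mem_ofPred_eq, θ.2, true_and]
      congr
    · have : {θ : Metric.sphere (0 : Euc 3) 1 | (θ : Euc 3) ∈ orthantSector b} =
          (fun θ : Metric.sphere (0 : Euc 3) 1 => (θ : Euc 3)) ⁻¹' C := by
        ext θ
        simp [orthantSector, hC]
      rw [this]
      exact (hCm.preimage continuous_subtype_val).measurableSet
  have hom : ∀ r : ℝ, 0 < r → ∀ x, f (r • x) = r * f x := by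
    intro r hr x
    have : r • x ∈ C ↔ x ∈ C := by
      simp only [hC, mem_ofPred_eq, real_inner_smul_right, mul_nonneg_iff_of_pos_left hr]
    by_cases hx : x ∈ C
    · rw [hf, indicator_of_mem hx, indicator_of_mem (this.2 hx), real_inner_smul_left,
        mul_max_of_nonneg _ _ hr.le, mul_zero]
    · rw [hf, indicator_of_notMem hx, indicator_of_notMem (mt this.1 hx), mul_zero]
  set g : Fin 3 → ℝ → ℝ := fun i => (Ici 0).indicator fun t =>
    (if i = j then t else 1) * Real.exp (-t ^ 2) with hg
  have h2 : ∫ x : Euc 3, f x * Real.exp (-‖x‖ ^ 2) = ∏ i, ∫ t, g i t := by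
    rw [← integral_fintype_prod_volume_eq_prod,
      ← b.measurePreserving_repr_symm.integral_comp
        b.repr.symm.toHomeomorph.measurableEmbedding,
      ← (PiLp.volume_preserving_toLp (Fin 3)).integral_comp
        (MeasurableEquiv.toLp 2 (Fin 3 → ℝ)).measurableEmbedding]
    refine integral_congr_ae (.of_forall fun y => ?_)
    have hi : ∀ i, inner ℝ (b i) (b.repr.symm (WithLp.toLp 2 y)) = y i := by
      intro i
      rw [← b.repr_apply_apply]
      simp
    have hn : ‖b.repr.symm (WithLp.toLp 2 y)‖ ^ 2 = ∑ i, y i ^ 2 := by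
      rw [LinearIsometryEquiv.norm_map, EuclideanSpace.norm_sq_eq]
      simp
    simp only [hn, hf, indicator, hC, mem_ofPred_eq, hi, hg, mem_Ici]
    split_ifs with h
    · rw [real_inner_comm, hi, max_eq_left (h j)]
      simp only [h, if_true, Finset.prod_mul_distrib, ← Real.exp_sum, Finset.sum_neg_distrib]
      simp
    · push Not at h
      obtain ⟨i, hi⟩ := h
      rw [zero_mul, Finset.prod_eq_zero (Finset.mem_univ i)]
      simp [hi.not_ge]
  have h3 : ∀ i, ∫ t, g i t = if i = j then 1 / 2 else √Real.pi / 2 := by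
    intro i
    rw [hg]
    simp only
    rw [integral_indicator measurableSet_Ici, integral_Ici_eq_integral_Ioi]
    split_ifs with h
    · exact integral_id_mul_exp_neg_sq
    · simpa using integral_exp_neg_sq_Ioi
  have hpi := Real.mul_self_sqrt Real.pi_pos.le
  rw [Phi, h1, integral_sphereMeasure_eq_gaussian hom, h2, sphereArea_three]
  simp only [h3]
  have : ∏ i : Fin 3, (if i = j then 1 / 2 else √Real.pi / 2) = Real.pi / 8 := by
    fin_cases j <;> simp [Fin.prod_univ_three] <;> linear_combination hpi / 8
  rw [this]
  field_simp
  norm_num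

/-! ### The pitch of the spiral and the fundamental inequality -/

theorem exists_unique_spiralPitch :
    ∃ ω : ℝ, 0 < ω ∧ ω = Real.exp (-(3 * Real.pi / 2) * ω) ∧
      ∀ ω' : ℝ, ω' = Real.exp (-(3 * Real.pi / 2) * ω') → ω' = ω := by
  have hmono : StrictMono fun x : ℝ => x - Real.exp (-(3 * Real.pi / 2) * x) := by
    intro x y hxy
    have : Real.exp (-(3 * Real.pi / 2) * y) < Real.exp (-(3 * Real.pi / 2) * x) :=
      Real.exp_lt_exp.2 (by nlinarith [Real.pi_pos])
    simp only
    linarith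
  have hcont : ContinuousOn (fun x : ℝ => x - Real.exp (-(3 * Real.pi / 2) * x)) (Icc 0 1) := by
    fun_prop
  obtain ⟨ω, -, hω⟩ :
      (0 : ℝ) ∈ (fun x : ℝ => x - Real.exp (-(3 * Real.pi / 2) * x)) '' Icc 0 1 := by
    refine intermediate_value_Icc zero_le_one hcont ⟨by simp, ?_⟩
    simp only [sub_nonneg]
    exact Real.exp_le_one_iff.2 (by nlinarith [Real.pi_pos])
  replace hω := sub_eq_zero.1 hω
  refine ⟨ω, hω ▸ Real.exp_pos _, hω, fun ω' h => hmono.injective ?_⟩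
  rw [← h, ← hω, sub_self, sub_self]

/-- The fundamental inequality of the spiral. For `δ ≥ 0` it holds for every `ω`; on `[-3π/2, 0]`
the ratio of both sides decreases and then increases as `δ` moves away from `0`, and `ω` is such
that equality holds at both end points. -/
theorem cos_add_mul_sin_le_exp {ω : ℝ} (hω : 0 < ω)
    (h : ω = Real.exp (-(3 * Real.pi / 2) * ω)) {δ : ℝ} (hδ : -(3 * Real.pi / 2) ≤ δ) :
    Real.cos δ + ω * Real.sin δ ≤ Real.exp (ω * δ) := by
  have hpi := Real.pi_pos
  rcases le_total 0 δ with h0 | h0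
  · have h1 := Real.cos_le_one δ
    have h2 := Real.sin_le h0
    have h3 := Real.add_one_le_exp (ω * δ)
    nlinarith
  set G : ℝ → ℝ := fun x => Real.exp (-(ω * x)) * (Real.cos x + ω * Real.sin x) with hG
  have hd : ∀ x, HasDerivAt G (-((1 + ω ^ 2) * Real.exp (-(ω * x)) * Real.sin x)) x := by
    intro x
    have h1 : HasDerivAt (fun x => Real.exp (-(ω * x))) (Real.exp (-(ω * x)) * (-(ω * 1))) x :=
      ((hasDerivAt_id x).const_mul ω).neg.exp
    have h2 : HasDerivAt (fun x => Real.cos x + ω * Real.sin x)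
        (-Real.sin x + ω * Real.cos x) x :=
      (Real.hasDerivAt_cos x).add ((Real.hasDerivAt_sin x).const_mul ω)
    refine (h1.mul h2).congr_deriv ?_
    ring
  have hc : Continuous G := continuous_iff_continuousAt.2 fun x => (hd x).continuousAt
  have key : G δ ≤ 1 := by
    rcases le_total (-Real.pi) δ with h1 | h1
    · have hm : MonotoneOn G (Icc (-Real.pi) 0) := by
        refine monotoneOn_of_deriv_nonneg (convex_Icc _ _) hc.continuousOn
          (fun x _ => (hd x).differentiableAt.differentiableWithinAt) fun x hx => ?_
        rw [interior_Icc] at hx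
        rw [(hd x).deriv]
        have := Real.sin_nonpos_of_nonpos_of_neg_pi_le hx.2.le hx.1.le
        have := mul_nonneg (by positivity : 0 ≤ (1 + ω ^ 2) * Real.exp (-(ω * x)))
          (neg_nonneg.2 this)
        linarith
      calc G δ ≤ G 0 := hm ⟨h1, h0⟩ ⟨by linarith, le_rfl⟩ h0
        _ = 1 := by simp [hG]
    · have hm : AntitoneOn G (Icc (-(3 * Real.pi / 2)) (-Real.pi)) := by
        refine antitoneOn_of_deriv_nonpos (convex_Icc _ _) hc.continuousOn
          (fun x _ => (hd x).differentiableAt.differentiableWithinAt) fun x hx => ?_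
        rw [interior_Icc] at hx
        rw [(hd x).deriv]
        have : 0 ≤ Real.sin x := by
          rw [← Real.sin_add_two_pi]
          exact Real.sin_nonneg_of_nonneg_of_le_pi (by linarith [hx.1]) (by linarith [hx.2])
        have := mul_nonneg (by positivity : 0 ≤ (1 + ω ^ 2) * Real.exp (-(ω * x))) this
        linarith
      calc G δ ≤ G (-(3 * Real.pi / 2)) := hm ⟨le_rfl, by linarith⟩ ⟨hδ, h1⟩ hδ
        _ = 1 := by
          have e1 : Real.cos (-(3 * Real.pi / 2)) = 0 := by
            rw [← Real.cos_add_two_pi, show -(3 * Real.pi / 2) + 2 * Real.pi = Real.pi / 2 by ring,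
              Real.cos_pi_div_two]
          have e2 : Real.sin (-(3 * Real.pi / 2)) = 1 := by
            rw [← Real.sin_add_two_pi, show -(3 * Real.pi / 2) + 2 * Real.pi = Real.pi / 2 by ring,
              Real.sin_pi_div_two]
          rw [hG]
          simp only [e1, e2, zero_add, mul_one]
          nth_rewrite 2 [h]
          rw [← Real.exp_add, ← Real.exp_zero]
          congr 1
          ring
  have := mul_le_mul_of_nonneg_left key (Real.exp_pos (ω * δ)).le
  rwa [hG, ← mul_assoc, ← Real.exp_add, add_neg_cancel, Real.exp_zero, one_mul, mul_one] at this

/-- The fundamental inequality, rotated by `3π/2`: the tangent line at the end of the spiral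
supports the spiral. -/
theorem exp_mul_cos_sub_sin_le {ω : ℝ} (hω : 0 < ω)
    (h : ω = Real.exp (-(3 * Real.pi / 2) * ω)) {η : ℝ} (hη : 0 ≤ η) :
    Real.exp (-ω * η) * (ω * Real.cos η - Real.sin η) ≤ ω := by
  have key := cos_add_mul_sin_le_exp hω h (δ := η - 3 * Real.pi / 2) (by linarith)
  have e1 : Real.cos (η - 3 * Real.pi / 2) = -Real.sin η := by
    rw [← Real.cos_add_two_pi, ← Real.cos_add_pi_div_two]
    congr 1; ring
  have e2 : Real.sin (η - 3 * Real.pi / 2) = Real.cos η := by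
    rw [← Real.sin_add_two_pi, ← Real.sin_add_pi_div_two]
    congr 1; ring
  have e3 : Real.exp (ω * (η - 3 * Real.pi / 2)) = Real.exp (ω * η) * ω := by
    nth_rewrite 3 [h]
    rw [← Real.exp_add]
    congr 1; ring
  rw [e1, e2, e3] at key
  calc Real.exp (-ω * η) * (ω * Real.cos η - Real.sin η)
      ≤ Real.exp (-ω * η) * (Real.exp (ω * η) * ω) :=
        mul_le_mul_of_nonneg_left (by linarith) (Real.exp_pos _).le
    _ = ω := by
      rw [← mul_assoc, ← Real.exp_add, neg_mul, neg_add_cancel, Real.exp_zero, one_mul]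

/-! ### The support function of the planar logarithmic spiral -/

/-- The support function, on `ℝ² = ℂ`, of the logarithmic spiral `η ↦ e^{(i-ω)η}`, `0 ≤ η`. -/
noncomputable def spiralSupport (ω : ℝ) (z : ℂ) : ℝ :=
  sSup ((fun η => Real.exp (-ω * η) * (z.re * Real.cos η + z.im * Real.sin η)) '' Ici 0)

section spiralSupport

variable {ω : ℝ}

theorem exp_mul_re_cos_add_im_sin_le (z : ℂ) (η : ℝ) :
    |Real.exp (-ω * η) * (z.re * Real.cos η + z.im * Real.sin η)| ≤
      Real.exp (-ω * η) * ‖z‖ := by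
  rw [abs_mul, abs_of_pos (Real.exp_pos _)]
  refine mul_le_mul_of_nonneg_left ?_ (Real.exp_pos _).le
  refine abs_le_of_sq_le_sq ?_ (norm_nonneg z)
  rw [Complex.sq_norm, Complex.normSq_apply]
  nlinarith [sq_nonneg (z.re * Real.sin η - z.im * Real.cos η), Real.sin_sq_add_cos_sq η]

theorem exp_neg_mul_le_one (hω : 0 < ω) {η : ℝ} (hη : 0 ≤ η) : Real.exp (-ω * η) ≤ 1 :=
  Real.exp_le_one_iff.2 (by nlinarith)

theorem isLUB_spiralSupport (hω : 0 < ω) (z : ℂ) :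
    IsLUB ((fun η => Real.exp (-ω * η) * (z.re * Real.cos η + z.im * Real.sin η)) '' Ici 0)
      (spiralSupport ω z) := by
  refine isLUB_csSup ⟨_, mem_image_of_mem _ self_mem_Ici⟩ ⟨‖z‖, ?_⟩
  rintro _ ⟨η, hη, rfl⟩
  refine (le_abs_self _).trans ((exp_mul_re_cos_add_im_sin_le z η).trans ?_)
  exact mul_le_of_le_one_left (norm_nonneg z) (exp_neg_mul_le_one hω hη)

theorem le_spiralSupport (hω : 0 < ω) (z : ℂ) {η : ℝ} (hη : 0 ≤ η) :
    Real.exp (-ω * η) * (z.re * Real.cos η + z.im * Real.sin η) ≤ spiralSupport ω z :=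
  (isLUB_spiralSupport hω z).1 ⟨η, hη, rfl⟩

theorem spiralSupport_le (hω : 0 < ω) (z : ℂ) {M : ℝ}
    (h : ∀ η, 0 ≤ η → Real.exp (-ω * η) * (z.re * Real.cos η + z.im * Real.sin η) ≤ M) :
    spiralSupport ω z ≤ M := by
  refine (isLUB_spiralSupport hω z).2 ?_
  rintro _ ⟨η, hη, rfl⟩
  exact h η hη

theorem spiralSupport_le_norm (hω : 0 < ω) (z : ℂ) : spiralSupport ω z ≤ ‖z‖ :=
  spiralSupport_le hω z fun η hη =>
    (le_abs_self _).trans ((exp_mul_re_cos_add_im_sin_le z η).trans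
      (mul_le_of_le_one_left (norm_nonneg z) (exp_neg_mul_le_one hω hη)))

/-- The spiral accumulates at the origin. -/
theorem spiralSupport_nonneg (hω : 0 < ω) (z : ℂ) : 0 ≤ spiralSupport ω z := by
  have h1 : Tendsto (fun η => -(Real.exp (-ω * η) * ‖z‖)) atTop (𝓝 0) := by
    have : Tendsto (fun η : ℝ => Real.exp (-ω * η)) atTop (𝓝 0) :=
      Real.tendsto_exp_atBot.comp (tendsto_id.const_mul_atTop_of_neg (neg_lt_zero.2 hω))
    simpa using (this.mul_const ‖z‖).neg
  refine le_of_tendsto h1 ?_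
  filter_upwards [eventually_ge_atTop 0] with η hη
  exact (neg_le_of_abs_le (exp_mul_re_cos_add_im_sin_le z η)).trans (le_spiralSupport hω z hη)

theorem spiralSupport_real_mul {r : ℝ} (hr : 0 ≤ r) (z : ℂ) :
    spiralSupport ω (r * z) = r * spiralSupport ω z := by
  rw [spiralSupport, spiralSupport, ← smul_eq_mul r, ← Real.sSup_smul_of_nonneg hr, ← image_smul,
    image_image]
  congr 1
  refine image_congr fun η _ => ?_
  simp only [Complex.re_ofReal_mul, Complex.im_ofReal_mul, smul_eq_mul]
  ring

theorem continuous_spiralSupport (hω : 0 < ω) : Continuous (spiralSupport ω) := by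
  refine (LipschitzWith.of_le_add (f := spiralSupport ω) fun z w => ?_).continuous
  refine spiralSupport_le hω z fun η hη => ?_
  have h1 := le_spiralSupport hω w hη
  have h2 := (le_spiralSupport hω (z - w) hη).trans (spiralSupport_le_norm hω (z - w))
  rw [dist_eq_norm]
  simp only [Complex.sub_re, Complex.sub_im] at h2
  linarith

/-- On the directions `α ∈ [β, β + 3π/2]`, `tan β = ω`, the support function is attained at the
point of the spiral of angle `α - β`. -/
theorem spiralSupport_of_mem_arc (hω : 0 < ω) (h : ω = Real.exp (-(3 * Real.pi / 2) * ω)) {α : ℝ}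
    (hα : α ∈ Icc (Real.arctan ω) (Real.arctan ω + 3 * Real.pi / 2)) :
    spiralSupport ω (Real.cos α + Real.sin α * Complex.I) =
      Real.exp (-ω * (α - Real.arctan ω)) * Real.cos (Real.arctan ω) := by
  set β := Real.arctan ω with hβ
  have hcos : 0 < Real.cos β := Real.cos_arctan_pos ω
  have hsin : Real.sin β = ω * Real.cos β := by
    have := Real.tan_arctan ω
    rw [← hβ, Real.tan_eq_sin_div_cos] at this
    field_simp at this
    linarith
  apply le_antisymm
  · refine spiralSupport_le hω _ fun η hη => ?_
    have key := cos_add_mul_sin_le_exp hω h (δ := η - (α - β)) (by linarith [hα.2])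
    have e : Real.cos α * Real.cos η + Real.sin α * Real.sin η =
        Real.cos β * (Real.cos (η - (α - β)) + ω * Real.sin (η - (α - β))) := by
      have : Real.cos α * Real.cos η + Real.sin α * Real.sin η =
          Real.cos (η - (α - β) - β) := by
        rw [show η - (α - β) - β = η - α by ring, Real.cos_sub]; ring
      rw [this, Real.cos_sub, hsin]; ring
    simp only [Complex.add_re, Complex.ofReal_re, Complex.mul_re, Complex.I_re, Complex.ofReal_im,
      Complex.I_im, Complex.add_im, Complex.mul_im, mul_zero, mul_one, sub_zero, add_zero,
      zero_add]
    rw [e]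
    calc Real.exp (-ω * η) * (Real.cos β *
          (Real.cos (η - (α - β)) + ω * Real.sin (η - (α - β))))
        ≤ Real.exp (-ω * η) * (Real.cos β * Real.exp (ω * (η - (α - β)))) := by
          gcongr
      _ = Real.exp (-ω * (α - β)) * Real.cos β := by
          rw [mul_left_comm, ← Real.exp_add, mul_comm]
          congr 2; ring
  · have := le_spiralSupport hω (Real.cos α + Real.sin α * Complex.I) (η := α - β)
      (by linarith [hα.1])
    refine le_of_eq_of_le ?_ this
    congr 1
    simp only [Complex.add_re, Complex.ofReal_re, Complex.mul_re, Complex.I_re, Complex.ofReal_im,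
      Complex.I_im, Complex.add_im, Complex.mul_im, mul_zero, mul_one, sub_zero, add_zero,
      zero_add]
    rw [← Real.cos_sub]
    congr 1; ring

/-- On the remaining quarter of the directions, the support function is attained at the end
point `1` of the spiral. -/
theorem spiralSupport_of_mem_corner (hω : 0 < ω) (h : ω = Real.exp (-(3 * Real.pi / 2) * ω))
    {α : ℝ} (hα : α ∈ Icc (Real.arctan ω - Real.pi / 2) (Real.arctan ω)) :
    spiralSupport ω (Real.cos α + Real.sin α * Complex.I) = Real.cos α := by
  set β := Real.arctan ω with hβ
  have hcos : 0 < Real.cos β := Real.cos_arctan_pos ω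
  have hsin : Real.sin β = ω * Real.cos β := by
    have := Real.tan_arctan ω
    rw [← hβ, Real.tan_eq_sin_div_cos] at this
    field_simp at this
    linarith
  apply le_antisymm
  · refine spiralSupport_le hω _ fun η hη => ?_
    simp only [Complex.add_re, Complex.ofReal_re, Complex.mul_re, Complex.I_re, Complex.ofReal_im,
      Complex.I_im, Complex.add_im, Complex.mul_im, mul_zero, mul_one, sub_zero, add_zero,
      zero_add]
    -- A direction in this quarter is a nonnegative combination of the directions `β` and
    -- `β - π/2`, for which the bound is one of the two forms of the fundamental inequality.
    have k1 : Real.exp (-ω * η) * (Real.cos η + ω * Real.sin η) ≤ 1 := by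
      have := cos_add_mul_sin_le_exp hω h (δ := η) (by linarith [Real.pi_pos])
      calc _ ≤ Real.exp (-ω * η) * Real.exp (ω * η) := by gcongr
        _ = 1 := by rw [← Real.exp_add, neg_mul, neg_add_cancel, Real.exp_zero]
    have k2 := exp_mul_cos_sub_sin_le hω h hη
    have hs : 0 ≤ Real.sin (β - α) :=
      Real.sin_nonneg_of_nonneg_of_le_pi (by linarith [hα.2]) (by linarith [hα.1, Real.pi_pos])
    have hc : 0 ≤ Real.cos (β - α) :=
      Real.cos_nonneg_of_mem_Icc ⟨by linarith [hα.2, Real.pi_pos], by linarith [hα.1]⟩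
    have ec : Real.cos α = Real.cos β * (Real.cos (β - α) + ω * Real.sin (β - α)) := by
      rw [show α = β - (β - α) by ring, Real.cos_sub, hsin, sub_sub_cancel]
      ring
    have es : Real.sin α = Real.cos β * (ω * Real.cos (β - α) - Real.sin (β - α)) := by
      rw [show α = β - (β - α) by ring, Real.sin_sub, hsin, sub_sub_cancel]
      ring
    rw [ec, es]
    have := mul_le_mul_of_nonneg_left k1 (mul_nonneg hcos.le hc)
    have := mul_le_mul_of_nonneg_left k2 (mul_nonneg hcos.le hs)
    linarith
  · have := le_spiralSupport hω (Real.cos α + Real.sin α * Complex.I) le_rfl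
    refine le_of_eq_of_le ?_ this
    simp only [Complex.add_re, Complex.ofReal_re, Complex.mul_re, Complex.I_re, Complex.ofReal_im,
      Complex.I_im, mul_zero, mul_one, sub_zero, add_zero, Real.exp_zero, Real.cos_zero,
      Real.sin_zero, one_mul]

/-- The integral of the support function over the directions, i.e. the perimeter of the convex
hull of the spiral, is the length of the spiral. -/
theorem integral_spiralSupport_circle (hω : 0 < ω) (h : ω = Real.exp (-(3 * Real.pi / 2) * ω)) :
    ∫ α in (-Real.pi)..Real.pi, spiralSupport ω (Real.cos α + Real.sin α * Complex.I) =
      √(1 + ω ^ 2) / ω := by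
  set β := Real.arctan ω with hβ
  set F : ℝ → ℝ := fun α => spiralSupport ω (Real.cos α + Real.sin α * Complex.I) with hF
  have hper : Function.Periodic F (2 * Real.pi) := fun α => by
    simp only [hF, Real.cos_add_two_pi, Real.sin_add_two_pi]
  have hcont : Continuous F := (continuous_spiralSupport hω).comp (by fun_prop)
  have h1 : ∫ α in (-Real.pi)..Real.pi, F α =
      ∫ α in (β - Real.pi / 2)..(β + 3 * Real.pi / 2), F α := by
    have := hper.intervalIntegral_add_eq (-Real.pi) (β - Real.pi / 2)
    convert this using 2 <;> ring
  have h2 : ∫ α in (β - Real.pi / 2)..β, F α = Real.sin β + Real.cos β := by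
    rw [intervalIntegral.integral_congr (g := Real.cos), integral_cos, Real.sin_sub_pi_div_two]
    · ring
    · intro α hα
      rw [uIcc_of_le (by linarith [Real.pi_pos])] at hα
      exact spiralSupport_of_mem_corner hω h hα
  have h3 : ∫ α in β..(β + 3 * Real.pi / 2), F α = (1 - ω) / ω * Real.cos β := by
    rw [intervalIntegral.integral_congr
      (g := fun α => Real.exp (-ω * (α - β)) * Real.cos β)]
    · rw [intervalIntegral.integral_eq_sub_of_hasDerivAt
        (f := fun α => -(1 / ω) * Real.exp (-ω * (α - β)) * Real.cos β)]
      · have : Real.exp (-ω * (β + 3 * Real.pi / 2 - β)) = ω := by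
          nth_rewrite 2 [h]
          congr 1; ring
        rw [this, sub_self, mul_zero, Real.exp_zero]
        field_simp
        ring
      · intro α _
        have : HasDerivAt (fun α => Real.exp (-ω * (α - β)))
            (Real.exp (-ω * (α - β)) * (-ω * 1)) α :=
          (((hasDerivAt_id α).sub_const β).const_mul (-ω)).exp
        refine ((this.const_mul (-(1 / ω))).mul_const (Real.cos β)).congr_deriv ?_
        field_simp
      · exact (Continuous.intervalIntegrable (by fun_prop) _ _)
    · intro α hα
      rw [uIcc_of_le (by linarith [Real.pi_pos])] at hα
      exact spiralSupport_of_mem_arc hω h hα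
  rw [h1, ← intervalIntegral.integral_add_adjacent_intervals (hcont.intervalIntegrable _ β)
    (hcont.intervalIntegrable _ _), h2, h3, hβ, Real.sin_arctan, Real.cos_arctan]
  have hs : 0 < √(1 + ω ^ 2) := by positivity
  have hs2 : √(1 + ω ^ 2) ^ 2 = 1 + ω ^ 2 := Real.sq_sqrt (by positivity)
  field_simp
  rw [hs2]
  ring

/-- The planar Gaussian integral of the support function, in polar coordinates. -/
theorem integral_spiralSupport_gaussian (hω : 0 < ω)
    (h : ω = Real.exp (-(3 * Real.pi / 2) * ω)) :
    ∫ z : ℂ, spiralSupport ω z * Real.exp (-‖z‖ ^ 2) =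
      √Real.pi / 4 * (√(1 + ω ^ 2) / ω) := by
  rw [← Complex.integral_comp_polarCoord_symm, ← integral_spiralSupport_circle hω h,
    ← integral_sq_mul_exp_neg_sq, intervalIntegral.integral_of_le (by linarith [Real.pi_pos]),
    integral_Ioc_eq_integral_Ioo, ← setIntegral_prod_mul, polarCoord_target]
  refine setIntegral_congr_fun (measurableSet_Ioi.prod measurableSet_Ioo) fun p hp => ?_
  have hp0 : 0 < p.1 := hp.1
  simp only [Complex.norm_polarCoord_symm, sq_abs]
  rw [Complex.polarCoord_symm_apply, smul_eq_mul, spiralSupport_real_mul hp0.le]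
  ring

end spiralSupport

/-! ### Unit speed from unit derivatives -/

/-- The length of a differentiable arc of unit velocity is at least the elapsed time: the variation
on `[u, t]` grows in `t` at least at the rate `‖x'(t)‖`. -/
theorem ofReal_sub_le_eVariationOn {E : Type*} [NormedAddCommGroup E] [NormedSpace ℝ E]
    {x : ℝ → E} {u w : ℝ} (hL : LipschitzOnWith 1 x (Icc u w)) (huw : u ≤ w)
    (hd : ∀ s ∈ Ico u w, ∃ v, HasDerivAt x v s ∧ ‖v‖ = 1) :
    ENNReal.ofReal (w - u) ≤ eVariationOn x (Icc u w) := by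
  have hle : ∀ s t, u ≤ s → t ≤ w → eVariationOn x (Icc s t) ≤ ENNReal.ofReal (t - s) := by
    intro s t hs ht
    have := hL.comp_eVariationOn_le (f := x) (g := id) (s := Icc s t)
      (fun y hy => ⟨hs.trans hy.1, hy.2.trans ht⟩)
    simpa [eVariationOn_id_Icc] using this
  have hfin : ∀ s t, u ≤ s → t ≤ w → eVariationOn x (Icc s t) ≠ ⊤ := fun s t hs ht =>
    ne_top_of_le_ne_top ENNReal.ofReal_ne_top (hle s t hs ht)
  set V : ℝ → ℝ := fun t => (eVariationOn x (Icc u t)).toReal with hV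
  have hadd : ∀ s t, u ≤ s → s ≤ t → t ≤ w →
      V t - V s = (eVariationOn x (Icc s t)).toReal := by
    intro s t hs hst ht
    have h1 := eVariationOn.Icc_add_Icc x hs hst (mem_univ s)
    simp only [univ_inter] at h1
    simp only [hV]
    rw [← h1, ENNReal.toReal_add (hfin u s le_rfl (hst.trans ht)) (hfin s t hs ht)]
    ring
  have hup : ∀ s t, u ≤ s → s ≤ t → t ≤ w → V t - V s ≤ t - s := by
    intro s t hs hst ht
    rw [hadd s t hs hst ht]
    exact ENNReal.toReal_le_of_le_ofReal (by linarith) (hle s t hs ht)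
  have hlow : ∀ s t, u ≤ s → s ≤ t → t ≤ w → ‖x t - x s‖ ≤ V t - V s := by
    intro s t hs hst ht
    rw [hadd s t hs hst ht, ← dist_eq_norm, dist_edist]
    exact ENNReal.toReal_mono (hfin s t hs ht)
      (eVariationOn.edist_le x ⟨hst, le_rfl⟩ ⟨le_rfl, hst⟩)
  have hVc : ContinuousOn V (Icc u w) := by
    refine (LipschitzOnWith.of_dist_le_mul (K := 1) fun s hs t ht => ?_).continuousOn
    rw [NNReal.coe_one, one_mul, Real.dist_eq, Real.dist_eq]
    rcases le_total s t with h | h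
    · rw [abs_sub_comm, abs_sub_comm s, abs_of_nonneg (sub_nonneg.2 h), abs_of_nonneg]
      · exact hup s t hs.1 h ht.2
      · exact (norm_nonneg _).trans (hlow s t hs.1 h ht.2)
    · rw [abs_of_nonneg (sub_nonneg.2 h), abs_of_nonneg]
      · exact hup t s ht.1 h hs.2
      · exact (norm_nonneg _).trans (hlow t s ht.1 h hs.2)
  have hfence := image_le_of_liminf_slope_right_le_deriv_boundary (a := u) (b := w)
    (f := fun t => t - u - V t) (B := fun _ => 0) (B' := fun _ => 0)
    ((by fun_prop : ContinuousOn (fun t : ℝ => t - u) (Icc u w)).sub hVc)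
    (by simp [hV]) continuousOn_const (fun s _ => hasDerivWithinAt_const _ _ _) (by
      intro s hs r hr
      obtain ⟨v, hv, hv1⟩ := hd s hs
      have ht : Tendsto (fun z => ‖slope x s z‖) (𝓝[>] s) (𝓝 1) := by
        rw [← hv1]
        exact ((hasDerivAt_iff_tendsto_slope.1 hv).mono_left
          (nhdsWithin_mono _ fun z hz => ne_of_gt hz)).norm
      refine Eventually.frequently ?_
      filter_upwards [ht.eventually (lt_mem_nhds (show 1 - r < 1 by linarith)),
        Ioc_mem_nhdsGT hs.2] with z hz hzs
      have hzs' : 0 < z - s := sub_pos.2 hzs.1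
      rw [slope_def_module, norm_smul, norm_inv, Real.norm_of_nonneg hzs'.le] at hz
      rw [slope_def_field, div_lt_iff₀ hzs']
      have h1 := hlow s z hs.1 hzs.1.le hzs.2
      rw [lt_inv_mul_iff₀ hzs'] at hz
      nlinarith)
  have h1 := hfence (right_mem_Icc.2 huw)
  rw [ENNReal.ofReal_le_iff_le_toReal (hfin u w le_rfl le_rfl)]
  linarith

theorem hasUnitSpeedOn_Icc_of_hasDerivAt {E : Type*} [NormedAddCommGroup E] [NormedSpace ℝ E]
    {x : ℝ → E} {a b : ℝ} (hc : ContinuousOn x (Icc a b))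
    (hd : ∀ s ∈ Ioo a b, ∃ v, HasDerivAt x v s ∧ ‖v‖ = 1) : HasUnitSpeedOn x (Icc a b) := by
  rcases le_or_gt b a with hab | hab
  · exact hasConstantSpeedOnWith_of_subsingleton _ (subsingleton_Icc_of_ge hab) _
  have hL : LipschitzOnWith 1 x (Icc a b) := by
    rw [← closure_Ioo hab.ne] at hc ⊢
    choose! v hv hv1 using hd
    refine LipschitzOnWith.closure hc ?_
    exact (convex_Ioo a b).lipschitzOnWith_of_nnnorm_hasDerivWithin_le
      (fun s hs => (hv s hs).hasDerivWithinAt) fun s hs => by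
        rw [← NNReal.coe_le_coe, coe_nnnorm, hv1 s hs, NNReal.coe_one]
  refine hasConstantSpeedOnWith_iff_ordered.2 fun u hu w hw huw => ?_
  have hsub : Icc u w ⊆ Icc a b := Icc_subset_Icc hu.1 hw.2
  rw [inter_eq_right.2 hsub, NNReal.coe_one, one_mul]
  apply le_antisymm
  · have := (hL.mono hsub).comp_eVariationOn_le (f := x) (g := id) (s := Icc u w) (mapsTo_id _)
    simpa [eVariationOn_id_Icc] using this
  · have hlim : Tendsto (fun u' => ENNReal.ofReal (w - u')) (𝓝[>] u) (𝓝 (ENNReal.ofReal (w - u))) :=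
      (ENNReal.continuous_ofReal.comp
        (continuous_const.sub continuous_id)).continuousAt.tendsto.mono_left nhdsWithin_le_nhds
    rcases huw.eq_or_lt with rfl | huw
    · simp
    -- `u` may be the end point `a`, where no derivative is assumed.
    refine le_of_tendsto hlim ?_
    filter_upwards [Ioo_mem_nhdsGT huw] with u' hu'
    refine (ofReal_sub_le_eVariationOn
      (hL.mono ((Icc_subset_Icc_left hu'.1.le).trans hsub)) hu'.2.le fun s hs => ?_).trans
      (eVariationOn.mono x (Icc_subset_Icc_left hu'.1.le))
    exact hd s ⟨hu.1.trans_lt (hu'.1.trans_le hs.1), hs.2.trans_le hw.2⟩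

/-! ### Differentiating the integral of a maximum -/

section max

variable {α : Type*} [MeasurableSpace α] {μ : Measure α} {A B : α → ℝ}

/-- At a tie `r₀ A p = B p` with `B p > 0` the integrand has a corner; a tie with `B p = 0` is
harmless, as then `A p = 0`. -/
theorem hasDerivAt_integral_max (hA : Integrable A μ) (hB : Integrable B μ) (hAm : Measurable A)
    (hBm : Measurable B) (hB0 : ∀ p, 0 ≤ B p) {r₀ : ℝ} (hr : 0 < r₀)
    (hnull : ∀ᵐ p ∂μ, 0 < B p → r₀ * A p ≠ B p) :
    HasDerivAt (fun r => ∫ p, max (r * A p) (B p) ∂μ)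
      (∫ p, {p | B p < r₀ * A p}.indicator A p ∂μ) r₀ := by
  refine (hasDerivAt_integral_of_dominated_loc_of_lip (s := univ) (bound := A) univ_mem
    (.of_forall fun r => ((hAm.const_mul r).max hBm).aestronglyMeasurable)
    ((hA.const_mul r₀).sup hB) ?_ (.of_forall fun p => ?_) hA ?_).2
  · exact (hAm.indicator (measurableSet_lt hBm (hAm.const_mul r₀))).aestronglyMeasurable
  · refine LipschitzOnWith.of_dist_le_mul fun r _ r' _ => ?_
    rw [Real.dist_eq, Real.dist_eq, Real.coe_nnabs]
    refine (abs_max_sub_max_le_abs _ _ _).trans ?_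
    rw [← sub_mul, abs_mul, mul_comm]
  · filter_upwards [hnull] with p hp
    rcases lt_trichotomy (B p) (r₀ * A p) with h | h | h
    · rw [indicator_of_mem (show p ∈ {p | B p < r₀ * A p} from h)]
      have h1 : HasDerivAt (fun r : ℝ => r * A p) (A p) r₀ := by
        simpa using (hasDerivAt_id r₀).mul_const (A p)
      refine h1.congr_of_eventuallyEq ?_
      have hev : ∀ᶠ r in 𝓝 r₀, B p < r * A p := h1.continuousAt.eventually (lt_mem_nhds h)
      filter_upwards [hev] with r hr
      exact max_eq_left hr.le
    · have hBz : B p = 0 := by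
        by_contra hne
        exact hp (lt_of_le_of_ne (hB0 p) (Ne.symm hne)) h.symm
      have hAz : A p = 0 := by
        rw [hBz, eq_comm] at h
        exact (mul_eq_zero.1 h).resolve_left hr.ne'
      rw [indicator_of_notMem (show p ∉ {p | B p < r₀ * A p} by simp [hAz, hBz])]
      simpa [hAz, hBz] using hasDerivAt_const r₀ (0 : ℝ)
    · rw [indicator_of_notMem (show p ∉ {p | B p < r₀ * A p} from h.not_gt)]
      refine (hasDerivAt_const r₀ (B p)).congr_of_eventuallyEq ?_
      have hc : ContinuousAt (fun r : ℝ => r * A p) r₀ := by fun_prop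
      filter_upwards [hc.eventually (gt_mem_nhds h)] with r hr
      exact max_eq_right hr.le

theorem tendsto_integral_indicator_lt (hA : Integrable A μ) (hAm : Measurable A)
    (hBm : Measurable B) (hA0 : ∀ p, 0 ≤ A p) (hB0 : ∀ p, 0 ≤ B p) {r : ℕ → ℝ}
    (hr0 : ∀ m, 0 < r m) (hr : Tendsto r atTop (𝓝 0)) :
    Tendsto (fun m => ∫ p, {p | B p < r m * A p}.indicator A p ∂μ) atTop
      (𝓝 (∫ p, {p | B p = 0}.indicator A p ∂μ)) := by
  refine tendsto_integral_of_dominated_convergence A (fun m => ?_) hA (fun m => ?_) ?_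
  · exact (hAm.indicator (measurableSet_lt hBm (hAm.const_mul _))).aestronglyMeasurable
  · refine .of_forall fun p => ?_
    rw [Real.norm_of_nonneg (indicator_nonneg (fun p _ => hA0 p) p)]
    exact indicator_le_self' (fun p _ => hA0 p) p
  · refine .of_forall fun p => ?_
    rcases (hB0 p).eq_or_lt with h | h
    · rw [indicator_of_mem (show p ∈ {p | B p = 0} from h.symm)]
      refine tendsto_const_nhds.congr fun m => ?_
      rcases (hA0 p).eq_or_lt with h' | h'
      · simp [indicator, ← h']
      · rw [indicator_of_mem]
        simp only [mem_ofPred_eq, ← h]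
        exact mul_pos (hr0 m) h'
    · rw [indicator_of_notMem (show p ∉ {p | B p = 0} from h.ne')]
      refine tendsto_const_nhds.congr' ?_
      have h1 : Tendsto (fun m => r m * A p) atTop (𝓝 0) := by simpa using hr.mul_const (A p)
      filter_upwards [h1.eventually (gt_mem_nhds h)] with m hm
      rw [indicator_of_notMem]
      exact not_lt.2 hm.le

end max

/-! ### The curve: unit speed and the steepest descent property -/

section curve

variable {ω W : ℝ}

theorem segmentSpiral_of_le {s : ℝ} (hs : s ≤ W / 2) :
    segmentSpiral ω W s = !₂[0, 0, s - W / 2] := if_pos hs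

theorem segmentSpiral_of_gt {s : ℝ} (hs : W / 2 < s) : segmentSpiral ω W s =
    !₂[spiralRadius ω (s - W / 2) * Real.cos (spiralAngle ω (s - W / 2)),
      spiralRadius ω (s - W / 2) * Real.sin (spiralAngle ω (s - W / 2)), 0] := if_neg hs.not_ge

theorem spiralRadius_pos (hω : 0 < ω) {σ : ℝ} (hσ : 0 < σ) : 0 < spiralRadius ω σ := by
  unfold spiralRadius
  positivity

theorem spiralRadius_mono (hω : 0 < ω) : Monotone (spiralRadius ω) := fun σ τ h => by
  unfold spiralRadius
  gcongr

theorem spiralRadius_eq_mul_exp (hω : 0 < ω) {σ τ : ℝ} (hσ : 0 < σ) (hτ : 0 < τ) :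
    spiralRadius ω τ =
      spiralRadius ω σ * Real.exp (-ω * (spiralAngle ω τ - spiralAngle ω σ)) := by
  have e : -ω * (spiralAngle ω τ - spiralAngle ω σ) =
      Real.log (spiralRadius ω τ) - Real.log (spiralRadius ω σ) := by
    unfold spiralAngle
    field_simp
    ring
  rw [e, Real.exp_sub, Real.exp_log (spiralRadius_pos hω hσ), Real.exp_log (spiralRadius_pos hω hτ),
    mul_div_cancel₀ _ (spiralRadius_pos hω hσ).ne']

/-- The spiral turns towards smaller angles as it moves away from the origin. -/
theorem spiralAngle_anti (hω : 0 < ω) {σ τ : ℝ} (hτ : 0 < τ) (h : τ ≤ σ) :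
    spiralAngle ω σ ≤ spiralAngle ω τ := by
  have h1 := spiralRadius_mono hω h
  have h2 := Real.log_le_log (spiralRadius_pos hω hτ) h1
  have h3 : 0 < 1 / ω := by positivity
  unfold spiralAngle
  nlinarith

theorem hasDerivAt_spiralRadius (σ : ℝ) :
    HasDerivAt (spiralRadius ω) (ω / √(1 + ω ^ 2)) σ := by
  have := ((hasDerivAt_id σ).const_mul ω).div_const (√(1 + ω ^ 2))
  rw [mul_one] at this
  exact this

theorem hasDerivAt_euc {n : ℕ} {f : ℝ → Euc n} {v : Euc n} {s : ℝ}
    (h : ∀ i, HasDerivAt (fun t => f t i) (v i) s) : HasDerivAt f v s :=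
  (PiLp.continuousLinearEquiv 2 ℝ fun _ : Fin n => ℝ).symm.toContinuousLinearMap.hasFDerivAt
    |>.comp_hasDerivAt s (hasDerivAt_pi.2 h)

/-- The velocity of the spiral where its angle is `η`. -/
noncomputable def spiralVelocity (ω η : ℝ) : Euc 3 :=
  !₂[(ω * Real.cos η + Real.sin η) / √(1 + ω ^ 2),
    (ω * Real.sin η - Real.cos η) / √(1 + ω ^ 2), 0]

theorem norm_spiralVelocity (ω η : ℝ) : ‖spiralVelocity ω η‖ = 1 := by
  have h : ‖spiralVelocity ω η‖ ^ 2 = 1 := by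
    have hs2 : √(1 + ω ^ 2) ^ 2 = 1 + ω ^ 2 := Real.sq_sqrt (by positivity)
    simp only [spiralVelocity, EuclideanSpace.norm_sq_eq, Fin.sum_univ_three, Real.norm_eq_abs,
      sq_abs, Matrix.cons_val, div_pow, hs2]
    have := Real.sin_sq_add_cos_sq η
    field_simp
    linear_combination (1 + ω ^ 2) * this
  exact (pow_eq_one_iff_of_nonneg (norm_nonneg _) two_ne_zero).1 h

theorem hasDerivAt_segmentSpiral_of_lt {s : ℝ} (hs : s < W / 2) :
    HasDerivAt (segmentSpiral ω W) !₂[0, 0, 1] s := by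
  have h : HasDerivAt (fun s : ℝ => (!₂[0, 0, s - W / 2] : Euc 3)) !₂[0, 0, 1] s := by
    refine hasDerivAt_euc fun i => ?_
    fin_cases i
    · exact hasDerivAt_const s (0 : ℝ)
    · exact hasDerivAt_const s (0 : ℝ)
    · exact (hasDerivAt_id s).sub_const (W / 2)
  refine h.congr_of_eventuallyEq ?_
  filter_upwards [gt_mem_nhds hs] with t ht
  exact segmentSpiral_of_le ht.le

theorem hasDerivAt_segmentSpiral_of_gt (hω : 0 < ω) {s : ℝ} (hs : W / 2 < s) :
    HasDerivAt (segmentSpiral ω W) (spiralVelocity ω (spiralAngle ω (s - W / 2))) s := by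
  have hσ : 0 < s - W / 2 := sub_pos.2 hs
  have hr := spiralRadius_pos hω hσ
  have hR : HasDerivAt (fun s => spiralRadius ω (s - W / 2)) (ω / √(1 + ω ^ 2)) s := by
    simpa using (hasDerivAt_spiralRadius (ω := ω) (s - W / 2)).comp_sub_const s (W / 2)
  have hA : HasDerivAt (fun s => spiralAngle ω (s - W / 2))
      (-(1 / ω) * (ω / √(1 + ω ^ 2) / spiralRadius ω (s - W / 2))) s :=
    (hR.log hr.ne').const_mul _
  set r := spiralRadius ω (s - W / 2) with hrdef
  set η := spiralAngle ω (s - W / 2) with hηdef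
  have h : HasDerivAt (fun s => (!₂[spiralRadius ω (s - W / 2) *
        Real.cos (spiralAngle ω (s - W / 2)),
      spiralRadius ω (s - W / 2) * Real.sin (spiralAngle ω (s - W / 2)), 0] : Euc 3))
      (spiralVelocity ω η) s := by
    refine hasDerivAt_euc fun i => ?_
    fin_cases i
    · refine (hR.mul hA.cos).congr_deriv ?_
      simp only [spiralVelocity, ← hrdef, ← hηdef, Fin.zero_eta, PiLp.toLp_apply, Matrix.cons_val]
      field_simp
    · refine (hR.mul hA.sin).congr_deriv ?_
      simp only [spiralVelocity, ← hrdef, ← hηdef, Fin.mk_one, PiLp.toLp_apply, Matrix.cons_val]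
      field_simp
      ring
    · exact hasDerivAt_const s (0 : ℝ)
  refine h.congr_of_eventuallyEq ?_
  filter_upwards [lt_mem_nhds hs] with t ht
  exact segmentSpiral_of_gt ht

theorem norm_segmentSpiral_of_gt (hω : 0 < ω) {s : ℝ} (hs : W / 2 < s) :
    ‖segmentSpiral ω W s‖ = spiralRadius ω (s - W / 2) := by
  have hr := spiralRadius_pos hω (sub_pos.2 hs)
  rw [← abs_of_nonneg (norm_nonneg _), ← abs_of_pos hr, ← sq_eq_sq_iff_abs_eq_abs,
    segmentSpiral_of_gt hs, EuclideanSpace.norm_sq_eq]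
  simp only [Fin.sum_univ_three, Real.norm_eq_abs, sq_abs, Matrix.cons_val]
  linear_combination spiralRadius ω (s - W / 2) ^ 2 *
    Real.sin_sq_add_cos_sq (spiralAngle ω (s - W / 2))

theorem norm_segmentSpiral_of_le {s : ℝ} (hs : s ≤ W / 2) :
    ‖segmentSpiral ω W s‖ = W / 2 - s := by
  rw [segmentSpiral_of_le hs, EuclideanSpace.norm_eq]
  simp only [Fin.sum_univ_three, Real.norm_eq_abs, sq_abs, Matrix.cons_val]
  rw [← abs_of_nonneg (sub_nonneg.2 hs), ← Real.sqrt_sq_eq_abs]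
  congr 1
  ring

/-- At the origin both pieces of the curve have norm tending to zero. -/
theorem continuous_segmentSpiral (hω : 0 < ω) : Continuous (segmentSpiral ω W) := by
  refine continuous_iff_continuousAt.2 fun s => ?_
  rcases lt_trichotomy s (W / 2) with h | rfl | h
  · exact (hasDerivAt_segmentSpiral_of_lt h).continuousAt
  · have h0 : segmentSpiral ω W (W / 2) = 0 := by
      rw [← norm_eq_zero, norm_segmentSpiral_of_le le_rfl, sub_self]
    rw [ContinuousAt, h0]
    have hc : Continuous fun s => |W / 2 - s| + |spiralRadius ω (s - W / 2)| := by
      unfold spiralRadius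
      fun_prop
    have ht := hc.tendsto (W / 2)
    simp only [sub_self, abs_zero, spiralRadius, mul_zero, zero_div, add_zero] at ht
    refine squeeze_zero_norm (fun s => ?_) ht
    rcases le_or_gt s (W / 2) with h | h
    · rw [norm_segmentSpiral_of_le h]
      exact (le_abs_self _).trans (le_add_of_nonneg_right (abs_nonneg _))
    · rw [norm_segmentSpiral_of_gt hω h]
      exact (le_abs_self _).trans (le_add_of_nonneg_left (abs_nonneg _))
  · exact (hasDerivAt_segmentSpiral_of_gt hω h).continuousAt

theorem hasUnitSpeedOn_segmentSpiral (hω : 0 < ω) (L : ℝ) :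
    HasUnitSpeedOn (segmentSpiral ω W) (Icc 0 L) := by
  have h1 : HasUnitSpeedOn (segmentSpiral ω W) (Icc 0 (W / 2)) := by
    refine hasUnitSpeedOn_Icc_of_hasDerivAt (continuous_segmentSpiral hω).continuousOn
      fun s hs => ⟨_, hasDerivAt_segmentSpiral_of_lt hs.2, ?_⟩
    simp [EuclideanSpace.norm_eq, Fin.sum_univ_three]
  have h2 : HasUnitSpeedOn (segmentSpiral ω W) (Icc (W / 2) L) :=
    hasUnitSpeedOn_Icc_of_hasDerivAt (continuous_segmentSpiral hω).continuousOn
      fun s hs => ⟨_, hasDerivAt_segmentSpiral_of_gt hω hs.1, norm_spiralVelocity _ _⟩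
  exact h1.Icc_Icc h2

theorem inner_spiralVelocity_of_gt (η : ℝ) {τ : ℝ} (hτ : W / 2 < τ) :
    inner ℝ (spiralVelocity ω η) (segmentSpiral ω W τ) =
      spiralRadius ω (τ - W / 2) / √(1 + ω ^ 2) *
        (ω * Real.cos (spiralAngle ω (τ - W / 2) - η) -
          Real.sin (spiralAngle ω (τ - W / 2) - η)) := by
  rw [segmentSpiral_of_gt hτ, spiralVelocity, PiLp.inner_apply, Real.cos_sub, Real.sin_sub]
  simp only [Fin.sum_univ_three, Matrix.cons_val, RCLike.inner_apply,
    conj_trivial]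
  ring

/-- The tangent line of the spiral at `x s` has the earlier part of the curve on one side. -/
theorem inner_spiralVelocity_nonneg (hω : 0 < ω) (h : ω = Real.exp (-(3 * Real.pi / 2) * ω))
    {s τ : ℝ} (hs : W / 2 < s) (hτ : τ ≤ s) :
    0 ≤ inner ℝ (spiralVelocity ω (spiralAngle ω (s - W / 2)))
      (segmentSpiral ω W s - segmentSpiral ω W τ) := by
  have hσ : 0 < s - W / 2 := sub_pos.2 hs
  have hr := spiralRadius_pos hω hσ
  have hsq : 0 < √(1 + ω ^ 2) := by positivity
  rw [inner_sub_right, inner_spiralVelocity_of_gt _ hs, sub_self, Real.cos_zero, Real.sin_zero]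
  rcases le_or_gt τ (W / 2) with h1 | h1
  · have : inner ℝ (spiralVelocity ω (spiralAngle ω (s - W / 2))) (segmentSpiral ω W τ) = 0 := by
      rw [segmentSpiral_of_le h1, spiralVelocity, PiLp.inner_apply]
      simp [Fin.sum_univ_three]
    rw [this, mul_one, sub_zero, sub_zero]
    positivity
  · have hτ' : 0 < τ - W / 2 := sub_pos.2 h1
    have hη := sub_nonneg.2 (spiralAngle_anti hω hτ' (sub_le_sub_right hτ (W / 2)))
    rw [inner_spiralVelocity_of_gt _ h1, spiralRadius_eq_mul_exp hω hσ hτ']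
    have key := exp_mul_cos_sub_sin_le hω h hη
    have := mul_le_mul_of_nonneg_left key
      (by positivity : 0 ≤ spiralRadius ω (s - W / 2) / √(1 + ω ^ 2))
    rw [mul_one, sub_zero]
    linear_combination this

theorem isSteepestDescent_segmentSpiral (hω : 0 < ω)
    (h : ω = Real.exp (-(3 * Real.pi / 2) * ω)) {L : ℝ} (hL : 0 ≤ L) :
    IsSteepestDescent (segmentSpiral ω W) L where
  length_nonneg := hL
  unitSpeed := hasUnitSpeedOn_segmentSpiral hω L
  descent := by
    have hne : ∀ᵐ s ∂(volume.restrict (Icc 0 L)), s ≠ W / 2 :=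
      ae_restrict_of_ae (Measure.ae_ne volume (W / 2))
    filter_upwards [hne] with s hs
    rcases hs.lt_or_gt with hs | hs
    · refine ⟨_, hasDerivAt_segmentSpiral_of_lt hs, fun τ hτ => ?_⟩
      rw [segmentSpiral_of_le hs.le, segmentSpiral_of_le (hτ.2.trans hs.le), PiLp.inner_apply]
      simpa [Fin.sum_univ_three] using hτ.2
    · exact ⟨_, hasDerivAt_segmentSpiral_of_gt hω hs,
        fun τ hτ => inner_spiralVelocity_nonneg hω h hs hτ.2⟩

theorem spiralRadius_length (hω : 0 < ω) :
    spiralRadius ω (segmentSpiralLength ω W - W / 2) = W / 2 := by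
  have hsq : 0 < √(1 + ω ^ 2) := by positivity
  unfold spiralRadius segmentSpiralLength
  field_simp
  ring

theorem half_lt_segmentSpiralLength (hω : 0 < ω) (hW : 0 < W) :
    W / 2 < segmentSpiralLength ω W := by
  have : 0 < √(1 + ω ^ 2) / ω := by positivity
  unfold segmentSpiralLength
  nlinarith

/-- The whole curve lies in the ball of radius `W / 2`. -/
theorem hullWidth_segmentSpiral_le (hω : 0 < ω) (hW : 0 < W) :
    hullWidth (segmentSpiral ω W) (segmentSpiralLength ω W) ≤ W := by
  have hL := half_lt_segmentSpiralLength hω hW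
  have := meanWidth_convexHull_le (A := segmentSpiral ω W '' Icc 0 (segmentSpiralLength ω W))
    (R := W / 2) ⟨_, mem_image_of_mem _ (left_mem_Icc.2 (by linarith))⟩ (by
      rintro _ ⟨s, hs, rfl⟩
      rcases le_or_gt s (W / 2) with h | h
      · rw [norm_segmentSpiral_of_le h]
        linarith [hs.1]
      · rw [norm_segmentSpiral_of_gt hω h]
        have := hs.2
        exact (spiralRadius_mono hω (by linarith)).trans_eq (spiralRadius_length hω))
  rw [hullWidth]
  linarith

/-! ### The mean width along the spiral -/

/-- The support function of the initial arc: the segment contributes the part depending on the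
height, and the spiral up to arc length `s` is a rotated and scaled copy of the unit spiral. -/
theorem isLUB_segmentSpiral (hω : 0 < ω) (hW : 0 < W) {s : ℝ} (hs : W / 2 < s) (p : ℂ × ℝ) :
    IsLUB ((fun y => inner ℝ (eucOfProd p) y) '' (segmentSpiral ω W '' Icc 0 s))
      (max (spiralRadius ω (s - W / 2) *
          spiralSupport ω (Circle.exp (-spiralAngle ω (s - W / 2)) * p.1))
        (W / 2 * max (-p.2) 0)) := by
  have hσ : 0 < s - W / 2 := sub_pos.2 hs
  set r := spiralRadius ω (s - W / 2) with hrdef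
  set η := spiralAngle ω (s - W / 2) with hηdef
  have hr : 0 < r := spiralRadius_pos hω hσ
  have hseg : ∀ σ ≤ W / 2, inner ℝ (eucOfProd p) (segmentSpiral ω W σ) = (σ - W / 2) * p.2 := by
    intro σ h
    rw [segmentSpiral_of_le h, eucOfProd, PiLp.inner_apply]
    simp [Fin.sum_univ_three]
  have hspi : ∀ σ, W / 2 < σ → inner ℝ (eucOfProd p) (segmentSpiral ω W σ) =
      r * (Real.exp (-ω * (spiralAngle ω (σ - W / 2) - η)) *
        ((Circle.exp (-η) * p.1 : ℂ).re * Real.cos (spiralAngle ω (σ - W / 2) - η) +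
          (Circle.exp (-η) * p.1 : ℂ).im * Real.sin (spiralAngle ω (σ - W / 2) - η))) := by
    intro σ h
    have hre : (Circle.exp (-η) : ℂ).re = Real.cos η := by
      rw [Circle.coe_exp, Complex.exp_ofReal_mul_I_re, Real.cos_neg]
    have him : (Circle.exp (-η) : ℂ).im = -Real.sin η := by
      rw [Circle.coe_exp, Complex.exp_ofReal_mul_I_im, Real.sin_neg]
    rw [segmentSpiral_of_gt h, eucOfProd, PiLp.inner_apply,
      spiralRadius_eq_mul_exp hω hσ (sub_pos.2 h), ← hrdef, ← hηdef, Complex.mul_re,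
      Complex.mul_im, hre, him, Real.cos_sub, Real.sin_sub]
    simp only [Fin.sum_univ_three, Matrix.cons_val, RCLike.inner_apply,
      conj_trivial]
    set E := Real.exp (-ω * (spiralAngle ω (σ - W / 2) - η))
    set c := Real.cos (spiralAngle ω (σ - W / 2))
    set d := Real.sin (spiralAngle ω (σ - W / 2))
    linear_combination (-(r * E * (p.1.re * c + p.1.im * d))) * Real.sin_sq_add_cos_sq η
  constructor
  · rintro _ ⟨_, ⟨σ, hσ', rfl⟩, rfl⟩
    simp only
    rcases le_or_gt σ (W / 2) with h | h
    · rw [hseg σ h]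
      refine le_max_of_le_right ?_
      have h0 : 0 ≤ σ := hσ'.1
      calc (σ - W / 2) * p.2 = (W / 2 - σ) * -p.2 := by ring
        _ ≤ (W / 2 - σ) * max (-p.2) 0 :=
          mul_le_mul_of_nonneg_left (le_max_left _ _) (sub_nonneg.2 h)
        _ ≤ W / 2 * max (-p.2) 0 :=
          mul_le_mul_of_nonneg_right (by linarith) (le_max_right _ _)
    · rw [hspi σ h]
      refine le_max_of_le_left (mul_le_mul_of_nonneg_left (le_spiralSupport hω _ ?_) hr.le)
      exact sub_nonneg.2 (spiralAngle_anti hω (sub_pos.2 h) (by linarith [hσ'.2]))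
  · intro M hM
    have hM' : ∀ σ ∈ Icc 0 s, inner ℝ (eucOfProd p) (segmentSpiral ω W σ) ≤ M :=
      fun σ hσ => hM ⟨_, ⟨σ, hσ, rfl⟩, rfl⟩
    have h0 := hM' 0 ⟨le_rfl, by linarith⟩
    have h1 := hM' (W / 2) ⟨by linarith, hs.le⟩
    rw [hseg _ (by linarith)] at h0 h1
    refine max_le ?_ ?_
    · rw [← spiralSupport_real_mul hr.le]
      refine spiralSupport_le hω _ fun Δ hΔ => ?_
      -- The point of the spiral at angle `Δ` behind its end.
      have hE : 0 < Real.exp (-ω * Δ) := Real.exp_pos _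
      have hE1 := exp_neg_mul_le_one hω hΔ
      have hpos : 0 < (s - W / 2) * Real.exp (-ω * Δ) := by positivity
      have hang : spiralAngle ω ((s - W / 2) * Real.exp (-ω * Δ)) - η = Δ := by
        have hR : spiralRadius ω ((s - W / 2) * Real.exp (-ω * Δ)) = r * Real.exp (-ω * Δ) := by
          rw [hrdef]
          unfold spiralRadius
          ring
        rw [hηdef]
        unfold spiralAngle
        rw [hR, ← hrdef, Real.log_mul hr.ne' hE.ne', Real.log_exp]
        field_simp
        ring
      have h2 := hM' (W / 2 + (s - W / 2) * Real.exp (-ω * Δ)) ⟨by linarith, by nlinarith⟩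
      rw [hspi _ (by linarith), add_sub_cancel_left, hang] at h2
      refine le_of_eq_of_le ?_ h2
      rw [Complex.re_ofReal_mul, Complex.im_ofReal_mul]
      ring
    · rw [mul_max_of_nonneg _ _ (by linarith)]
      exact max_le (by linarith) (by linarith)

/-- The Gaussian weighted support function of the unit spiral. -/
noncomputable def spiralPart (ω : ℝ) (p : ℂ × ℝ) : ℝ :=
  spiralSupport ω p.1 * Real.exp (-‖p.1‖ ^ 2) * Real.exp (-p.2 ^ 2)

/-- The Gaussian weighted support function of the segment. -/
noncomputable def segmentPart (W : ℝ) (p : ℂ × ℝ) : ℝ :=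
  Real.exp (-‖p.1‖ ^ 2) * (W / 2 * max (-p.2) 0 * Real.exp (-p.2 ^ 2))

theorem integrable_exp_neg_sq : Integrable fun t : ℝ => Real.exp (-t ^ 2) := by
  simpa using integrable_exp_neg_mul_sq one_pos

theorem integrable_exp_neg_norm_sq : Integrable fun z : ℂ => Real.exp (-‖z‖ ^ 2) := by
  refine (integrable_fun_norm_addHaar volume (f := fun r => Real.exp (-r ^ 2))).2 ?_
  simp only [Complex.finrank_real_complex, Nat.add_one_sub_one, pow_one, smul_eq_mul]
  -- The integral of a non-integrable function would be the junk value `0`.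
  by_contra hne
  have h := integral_id_mul_exp_neg_sq
  rw [integral_undef hne] at h
  norm_num at h

theorem integrable_spiralSupport_gaussian (hω : 0 < ω) :
    Integrable fun z : ℂ => spiralSupport ω z * Real.exp (-‖z‖ ^ 2) := by
  have h1 : Integrable fun z : ℂ => ‖z‖ * Real.exp (-‖z‖ ^ 2) := by
    refine (integrable_fun_norm_addHaar volume (f := fun r => r * Real.exp (-r ^ 2))).2 ?_
    simp only [Complex.finrank_real_complex, Nat.add_one_sub_one, pow_one, smul_eq_mul]
    -- As above, the integral is not `0`.
    by_contra hne
    have h := integral_sq_mul_exp_neg_sq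
    simp only [pow_two, mul_assoc] at h hne
    rw [integral_undef hne] at h
    have : 0 < √Real.pi / 4 := by positivity
    linarith
  refine h1.mono' ?_ (.of_forall fun z => ?_)
  · exact ((continuous_spiralSupport hω).mul (by fun_prop)).aestronglyMeasurable
  · rw [norm_mul, Real.norm_of_nonneg (spiralSupport_nonneg hω z),
      Real.norm_of_nonneg (Real.exp_pos _).le]
    exact mul_le_mul_of_nonneg_right (spiralSupport_le_norm hω z) (Real.exp_pos _).le

theorem integrable_spiralPart (hω : 0 < ω) : Integrable (spiralPart ω) :=
  (integrable_spiralSupport_gaussian hω).mul_prod integrable_exp_neg_sq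

theorem integrable_segmentPart (W : ℝ) : Integrable (segmentPart W) := by
  refine integrable_exp_neg_norm_sq.mul_prod
    (g := fun t : ℝ => W / 2 * max (-t) 0 * Real.exp (-t ^ 2)) ?_
  have h : Integrable fun t : ℝ => t * Real.exp (-t ^ 2) := by
    simpa using integrable_mul_exp_neg_mul_sq one_pos
  have h2 : Integrable fun t : ℝ => max (-(t * Real.exp (-t ^ 2))) 0 := h.neg.pos_part
  refine (h2.const_mul (W / 2)).congr (.of_forall fun t => ?_)
  simp only
  rw [mul_assoc, max_mul_of_nonneg _ _ (Real.exp_pos _).le, zero_mul, neg_mul]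

theorem continuous_spiralPart (hω : 0 < ω) : Continuous (spiralPart ω) := by
  have := continuous_spiralSupport hω
  unfold spiralPart
  fun_prop

theorem continuous_segmentPart (W : ℝ) : Continuous (segmentPart W) := by
  unfold segmentPart
  fun_prop

/-- Rotating the spiral back to the angle `0` does not change the Gaussian integral, so that the
mean width of the initial arc depends on the radius reached only. -/
theorem hullWidth_segmentSpiral (hω : 0 < ω) (hW : 0 < W) {s : ℝ} (hs : W / 2 < s) :
    hullWidth (segmentSpiral ω W) s = 1 / Real.pi *
      ∫ p, max (spiralRadius ω (s - W / 2) * spiralPart ω p) (segmentPart W p) := by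
  set r := spiralRadius ω (s - W / 2) with hrdef
  set R := rotation (Circle.exp (-spiralAngle ω (s - W / 2))) with hR
  have hmp : MeasurePreserving (Prod.map R (id : ℝ → ℝ)) :=
    R.measurePreserving.prod (MeasurePreserving.id volume)
  have hme : MeasurableEmbedding (Prod.map R (id : ℝ → ℝ)) :=
    R.toHomeomorph.measurableEmbedding.prodMap (MeasurableEquiv.refl ℝ).measurableEmbedding
  have hRn : ∀ z, ‖R z‖ = ‖z‖ := R.norm_map
  have hRe : ∀ z, (Circle.exp (-spiralAngle ω (s - W / 2)) : ℂ) * z = R z := fun z => by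
    rw [hR, rotation_apply]
  have hfun : (fun x : Euc 3 => supportFun (convexHull ℝ (segmentSpiral ω W '' Icc 0 s)) x *
      Real.exp (-‖x‖ ^ 2)) ∘ eucOfProd =
      (fun p => max (r * spiralPart ω p) (segmentPart W p)) ∘ Prod.map R (id : ℝ → ℝ) := by
    ext p
    simp only [Function.comp_apply, Prod.map, id, spiralPart, segmentPart,
      hRn, norm_eucOfProd_sq, neg_add, Real.exp_add,
      supportFun_convexHull (isLUB_segmentSpiral hω hW hs p), hRe, ← hrdef]
    rw [max_mul_of_nonneg _ _ (by positivity)]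
    congr 1 <;> ring
  have hint : Integrable fun p => max (r * spiralPart ω p) (segmentPart W p) :=
    ((integrable_spiralPart hω).const_mul r).sup (integrable_segmentPart W)
  obtain ⟨ep, em⟩ := measurePreserving_eucOfProd
  rw [hullWidth, meanWidth_eq_gaussian]
  · rw [← ep.integral_comp em, ← hmp.integral_comp hme
      (fun p => max (r * spiralPart ω p) (segmentPart W p))]
    exact congrArg (fun f : ℂ × ℝ → ℝ => 1 / Real.pi * ∫ p, f p) hfun
  · rw [← ep.integrable_comp_emb em, hfun, hmp.integrable_comp_emb hme]
    exact hint

theorem ae_spiralPart_ne_segmentPart (hω : 0 < ω) (hW : 0 < W) (r : ℝ) :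
    ∀ᵐ p, 0 < segmentPart W p → r * spiralPart ω p ≠ segmentPart W p := by
  -- Equality forces the height to be a function of the horizontal part.
  set φ : ℂ → ℝ := fun z => -(2 / W) * (r * spiralSupport ω z) with hφ
  have hφc : Continuous φ := by
    have := continuous_spiralSupport hω
    fun_prop
  have hnull : (volume : Measure (ℂ × ℝ)) {p | p.2 = φ p.1} = 0 := by
    have hclosed : IsClosed {p : ℂ × ℝ | p.2 = φ p.1} :=
      isClosed_eq continuous_snd (hφc.comp continuous_fst)
    rw [Measure.volume_eq_prod, Measure.measure_prod_null hclosed.measurableSet]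
    refine .of_forall fun z => ?_
    have : Prod.mk z ⁻¹' {p : ℂ × ℝ | p.2 = φ p.1} = {φ z} := by
      ext t
      simp
    simp only [this, Real.volume_singleton, Pi.zero_apply]
  refine measure_mono_null (fun p hp => ?_) hnull
  simp only [mem_compl_iff, mem_ofPred_eq, not_forall, not_not] at hp ⊢
  obtain ⟨hpos, heq⟩ := hp
  have hneg : p.2 < 0 := by
    by_contra hge
    rw [segmentPart, max_eq_right (by linarith)] at hpos
    simp at hpos
  rw [spiralPart, segmentPart, max_eq_left (by linarith)] at heq
  have h1 : Real.exp (-‖p.1‖ ^ 2) * Real.exp (-p.2 ^ 2) ≠ 0 := by positivity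
  have h2 : r * spiralSupport ω p.1 = W / 2 * -p.2 :=
    mul_right_cancel₀ h1 (by linear_combination heq)
  rw [hφ]
  simp only
  rw [h2]
  field_simp

/-- The rate of growth of the mean width along the spiral. -/
noncomputable def widthRate (ω W s : ℝ) : ℝ :=
  1 / Real.pi * ((∫ p, {p | segmentPart W p <
    spiralRadius ω (s - W / 2) * spiralPart ω p}.indicator (spiralPart ω) p) *
      (ω / √(1 + ω ^ 2)))

theorem hasDerivAt_hullWidth_segmentSpiral (hω : 0 < ω) (hW : 0 < W) {s : ℝ} (hs : W / 2 < s) :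
    HasDerivAt (hullWidth (segmentSpiral ω W)) (widthRate ω W s) s := by
  have hr := spiralRadius_pos hω (sub_pos.2 hs)
  have h1 := hasDerivAt_integral_max (integrable_spiralPart hω) (integrable_segmentPart W)
    (continuous_spiralPart hω).measurable (continuous_segmentPart W).measurable
    (fun p => by unfold segmentPart; positivity) hr (ae_spiralPart_ne_segmentPart hω hW _)
  have hR : HasDerivAt (fun s => spiralRadius ω (s - W / 2)) (ω / √(1 + ω ^ 2)) s := by
    simpa using (hasDerivAt_spiralRadius (ω := ω) (s - W / 2)).comp_sub_const s (W / 2)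
  refine ((h1.comp s hR).const_mul (1 / Real.pi)).congr_of_eventuallyEq ?_
  filter_upwards [lt_mem_nhds hs] with t ht
  exact hullWidth_segmentSpiral hω hW ht

/-- In the limit the segment is infinitely long compared with the spiral, and only the directions
of the upper half space see the spiral. -/
theorem integral_spiralPart_halfSpace (hω : 0 < ω) (h : ω = Real.exp (-(3 * Real.pi / 2) * ω))
    (hW : 0 < W) :
    ∫ p, {p | segmentPart W p = 0}.indicator (spiralPart ω) p =
      Real.pi / 8 * (√(1 + ω ^ 2) / ω) := by
  have h1 : ∀ p : ℂ × ℝ, {p | segmentPart W p = 0}.indicator (spiralPart ω) p =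
      (spiralSupport ω p.1 * Real.exp (-‖p.1‖ ^ 2)) *
        (Ici 0).indicator (fun t : ℝ => Real.exp (-t ^ 2)) p.2 := by
    intro p
    have hiff : segmentPart W p = 0 ↔ p.2 ∈ Ici 0 := by
      have : segmentPart W p = 0 ↔ max (-p.2) 0 = 0 := by
        simp [segmentPart, hW.ne', Real.exp_ne_zero]
      rw [this, max_eq_right_iff, neg_nonpos, mem_Ici]
    by_cases hp : p.2 ∈ Ici 0
    · rw [indicator_of_mem (show p ∈ {p | segmentPart W p = 0} from hiff.2 hp),
        indicator_of_mem hp, spiralPart]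
    · rw [indicator_of_notMem (show p ∉ {p | segmentPart W p = 0} from mt hiff.1 hp),
        indicator_of_notMem hp, mul_zero]
  simp only [h1]
  rw [Measure.volume_eq_prod, integral_prod_mul
    (fun z : ℂ => spiralSupport ω z * Real.exp (-‖z‖ ^ 2))
    ((Ici 0).indicator fun t : ℝ => Real.exp (-t ^ 2)),
    integral_indicator measurableSet_Ici, integral_Ici_eq_integral_Ioi,
    integral_exp_neg_sq_Ioi, integral_spiralSupport_gaussian hω h]
  linear_combination (√(1 + ω ^ 2) / ω / 8) * Real.mul_self_sqrt Real.pi_pos.le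

theorem tendsto_widthRate (hω : 0 < ω) (h : ω = Real.exp (-(3 * Real.pi / 2) * ω)) (hW : 0 < W)
    {s : ℕ → ℝ} (hs : ∀ m, W / 2 < s m) (hlim : Tendsto s atTop (𝓝 (W / 2))) :
    Tendsto (fun m => widthRate ω W (s m)) atTop (𝓝 (1 / 8)) := by
  have hr : Tendsto (fun m => spiralRadius ω (s m - W / 2)) atTop (𝓝 0) := by
    have hc : Continuous fun s => spiralRadius ω (s - W / 2) := by
      unfold spiralRadius
      fun_prop
    simpa [spiralRadius, Function.comp_def] using (hc.tendsto (W / 2)).comp hlim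
  have h1 := tendsto_integral_indicator_lt (integrable_spiralPart hω)
    (continuous_spiralPart hω).measurable (continuous_segmentPart W).measurable
    (fun p => by
      have := spiralSupport_nonneg hω p.1
      unfold spiralPart
      positivity)
    (fun p => by unfold segmentPart; positivity)
    (fun m => spiralRadius_pos hω (sub_pos.2 (hs m))) hr
  rw [integral_spiralPart_halfSpace hω h hW] at h1
  have h2 := (h1.mul_const (ω / √(1 + ω ^ 2))).const_mul (1 / Real.pi)
  have hsq : 0 < √(1 + ω ^ 2) := by positivity
  have e : 1 / Real.pi * (Real.pi / 8 * (√(1 + ω ^ 2) / ω) * (ω / √(1 + ω ^ 2))) = 1 / 8 := by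
    field_simp
  rwa [e] at h2

end curve

theorem mainTheorem5 (W : ℝ) (hW : 0 < W) :
    (∀ (b : OrthonormalBasis (Fin 3) ℝ (Euc 3)) (j : Fin 3),
      Phi (orthantSector b) (b j) = 1 / 8) ∧
    ∃ ω : ℝ,
      (ω = Real.exp (-(3 * Real.pi / 2) * ω) ∧
        ∀ ω' : ℝ, ω' = Real.exp (-(3 * Real.pi / 2) * ω') → ω' = ω) ∧
      ∃ (γ : ℝ → Euc 3) (L s₀ : ℝ),
        γ = segmentSpiral ω W ∧ L = segmentSpiralLength ω W ∧ s₀ = W / 2 ∧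
        MemGammaW W γ L ∧ s₀ ∈ Ioo 0 L ∧
        ∃ s d : ℕ → ℝ,
          StrictAnti s ∧ (∀ m, s m ∈ Ioo s₀ L) ∧ Tendsto s atTop (𝓝 s₀) ∧
          (∀ m, HasDerivAt (hullWidth γ) (d m) (s m)) ∧
          Tendsto d atTop (𝓝 (1 / 8)) := by
  obtain ⟨ω, hω, h, huniq⟩ := exists_unique_spiralPitch
  have hL := half_lt_segmentSpiralLength hω hW
  obtain ⟨s, hanti, hmem, hlim⟩ := exists_seq_strictAnti_tendsto' hL
  refine ⟨Phi_orthantSector, ω, ⟨h, huniq⟩, _, _, _, rfl, rfl, rfl,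
    ⟨isSteepestDescent_segmentSpiral hω h (by linarith), hullWidth_segmentSpiral_le hω hW⟩,
    ⟨by linarith, hL⟩, s, fun m => widthRate ω W (s m), hanti, hmem, hlim,
    fun m => hasDerivAt_hullWidth_segmentSpiral hω hW (hmem m).1,
    tendsto_widthRate hω h hW (fun m => (hmem m).1) hlim⟩
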